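/- Let $d,n\ge 1$ be integers, let $\sigma>0$ and let $\delta\in(0,2^{-(d+3)}]$. If $\delta<2^{-(d+3)}$, put $$h:=\left(\frac{\pi\sigma^2(d+1)(d+2)\ln\left(\frac{1}{2^{d+3}\delta}\right)}{n}\right)^{\frac1{d+2}}>0;$$ if $\delta=2^{-(d+3)}$, let $h>0$ be arbitrary. Let $S=[0,h\lceil h^{-1}\rceil]^d\subset\mathbb R^d$ and let $\mu$ be the uniform distribution on $S$. For a function $r:S\to\mathbb R$ that is $1$-Lipschitz for the Euclidean distance, consider the model $Y=r(X)+\varepsilon$, where $X\sim\mu$ and $\varepsilon\sim\mathcal N(0,\sigma^2)$ is independent of $X$, and let $\mathcal D_n=((X_1,Y_1),\dots,(X_n,Y_n))$ be an i.i.d. sample with the same distribution as $(X,Y)$. Then for every regression estimate $\hat r_n$, that is, for every jointly measurable real-valued function $(x,D)\mapsto\hat r_n(x,D)$ of a point $x\in\mathbb R^d$ and of a data set $D\in(\mathbb R^d\times\mathbb R)^n$, with $\hat r_n(x):=\hat r_n(x,\mathcal D_n)$, there exists a $1$-Lipschitz function $r:S\to\mathbb R$ such that, when $X\sim\mu$ is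 independent of $\mathcal D_n$, $$\mathbb P\left(\left|\hat r_n(X)-r(X)\right|\ge\frac14\left(\frac{\sigma^2\ln\left(\frac{1}{2^{d+3}\delta}\right)}{n}\right)^{\frac1{d+2}}\right)\ge\delta.$$ -/

import Mathlib

open MeasureTheory ProbabilityTheory

noncomputable section

namespace RegressionLowerBound

/-- The cube `[0, h ⌈h⁻¹⌉]^d` in Euclidean space `ℝ^d`. -/
def cube (d : ℕ) (h : ℝ) : Set (EuclideanSpace ℝ (Fin d)) :=
  {x | ∀ i, x i ∈ Set.Icc (0 : ℝ) (h * (⌈h⁻¹⌉₊ : ℝ))}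

/-- The uniform distribution on the cube: Lebesgue measure conditioned on it. -/
def designLaw (d : ℕ) (h : ℝ) : Measure (EuclideanSpace ℝ (Fin d)) :=
  ProbabilityTheory.cond volume (cube d h)

/-- The law of `(X, Y)` with `Y = r(X) + ε`, where `X` is uniform on the cube and the noise
`ε ∼ N(0, σ²)` is independent of `X`. -/
def pairLaw (d : ℕ) (h σ : ℝ) (r : EuclideanSpace ℝ (Fin d) → ℝ) :
    Measure (EuclideanSpace ℝ (Fin d) × ℝ) :=
  ((designLaw d h).prod (gaussianReal 0 (σ ^ 2).toNNReal)).map (fun p => (p.1, r p.1 + p.2))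

/-- The joint law of `(X, 𝒟ₙ)`: the sample `𝒟ₙ = ((X₁, Y₁), …, (Xₙ, Yₙ))` consists of i.i.d. copies
of `(X, Y)`, and `X` is a new uniform point of the cube, independent of `𝒟ₙ`. -/
def jointLaw (d n : ℕ) (h σ : ℝ) (r : EuclideanSpace ℝ (Fin d) → ℝ) :
    Measure (EuclideanSpace ℝ (Fin d) × (Fin n → EuclideanSpace ℝ (Fin d) × ℝ)) :=
  (designLaw d h).prod (Measure.pi fun _ => pairLaw d h σ r)

/-- The side length `h` of the cells, chosen from `d, n, σ, δ`. -/
def cellSide (d n : ℕ) (σ δ : ℝ) : ℝ :=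
  (Real.pi * σ ^ 2 * ((d : ℝ) + 1) * ((d : ℝ) + 2) * Real.log (1 / (2 ^ (d + 3) * δ)) / (n : ℝ))
    ^ (1 / ((d : ℝ) + 2))

end RegressionLowerBound

end

namespace RegressionLowerBound

open scoped NNReal ENNReal

/-! The proof averages over many hypotheses, one for each choice of signs on the cells of a grid of
side `h`. Let `g` be the sup-norm distance to the grid walls and let `r_c = ± g`, with the sign `c`
constant on each cell. Since `g` vanishes on the walls, every `r_c` is 1-Lipschitz.

If `g x ≥ t`, flipping the sign on the cell of `x` moves the target value by at least `2t`, so every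
data set produces an error at least `t` under one of the two hypotheses. The two sample laws
overlap: the two error probabilities sum to at least `exp (-(2/π) n κ / σ²) / 4`, where `κ` bounds
the integral of `g²` over one cell (`le_pi_observationLaw_add_pi_observationLaw`). Averaging over
all sign patterns and over `x` yields one pattern that is bad enough
(`exists_sign_le_measure_abs_sub`).

With `t = h/4`, the event `g ≥ t` has probability at least `2^(-d)`, and `κ = h^(d+2) /
(2(d+1)(d+2))` is admissible. The choice of `h` turns the exponential into `2^(d+3) δ`, and the
constants multiply to `2δ`; the factor 2 is lost in pairing the hypotheses. -/

/-! ### Overlap of two Gaussian product measures. -/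

theorem pi_withDensity {ι : Type*} [Fintype ι] {α : ι → Type*} [∀ i, MeasurableSpace (α i)]
    (ν : ∀ i, Measure (α i)) [∀ i, IsProbabilityMeasure (ν i)] (ρ : ∀ i, α i → ℝ≥0∞)
    (hρ : ∀ i, Measurable (ρ i)) [∀ i, SigmaFinite ((ν i).withDensity (ρ i))] :
    Measure.pi (fun i => (ν i).withDensity (ρ i)) =
      (Measure.pi ν).withDensity (fun x => ∏ i, ρ i (x i)) := by
  refine Measure.pi_eq fun s hs => ?_
  rw [withDensity_apply _ (MeasurableSet.univ_pi hs),
    ← lintegral_indicator (MeasurableSet.univ_pi hs)]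
  have key : ∀ x : ∀ i, α i, (Set.univ.pi s).indicator (fun x => ∏ i, ρ i (x i)) x
      = ∏ i, (s i).indicator (ρ i) (x i) := by
    intro x
    classical
    by_cases hx : x ∈ Set.univ.pi s
    · rw [Set.indicator_of_mem hx]
      exact Finset.prod_congr rfl fun i _ => (Set.indicator_of_mem (hx i trivial) _).symm
    · rw [Set.indicator_of_notMem hx]
      simp only [Set.mem_univ_pi, not_forall] at hx
      obtain ⟨i, hi⟩ := hx
      exact (Finset.prod_eq_zero (Finset.mem_univ i) (Set.indicator_of_notMem hi _)).symm
  simp_rw [key]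
  have hind : iIndepFun (fun i (x : ∀ i, α i) => (s i).indicator (ρ i) (x i)) (Measure.pi ν) :=
    iIndepFun_pi (X := fun i => (s i).indicator (ρ i))
      fun i => ((hρ i).indicator (hs i)).aemeasurable
  rw [lintegral_prod_eq_prod_lintegral_of_indepFun Finset.univ _ hind
    fun i => ((hρ i).indicator (hs i)).comp (measurable_pi_apply i)]
  refine Finset.prod_congr rfl fun i _ => ?_
  rw [withDensity_apply _ (hs i), ← lintegral_indicator (hs i)]
  exact (measurePreserving_eval ν i).lintegral_comp ((hρ i).indicator (hs i))

theorem gaussianReal_eq_withDensity (a : ℝ) {v : ℝ≥0} (hv : v ≠ 0) :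
    gaussianReal a v =
      (gaussianReal 0 v).withDensity (fun x => ENNReal.ofReal (Real.exp (a * x / v - a ^ 2 / (2 * v)))) := by
  rw [gaussianReal_of_var_ne_zero _ hv, gaussianReal_of_var_ne_zero _ hv,
    ← withDensity_mul _ (measurable_gaussianPDF 0 v) (by fun_prop)]
  congr 1
  ext x
  simp only [gaussianPDF, Pi.mul_apply]
  rw [← ENNReal.ofReal_mul (gaussianPDFReal_nonneg _ _ _)]
  congr 1
  simp only [gaussianPDFReal]
  conv_rhs => rw [mul_assoc, ← Real.exp_add]
  congr 2
  have : (v : ℝ) ≠ 0 := by exact_mod_cast hv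
  field_simp
  ring

theorem pi_gaussianReal_eq_withDensity {ι : Type*} [Fintype ι] (a : ι → ℝ) {v : ℝ≥0} (hv : v ≠ 0) :
    Measure.pi (fun i => gaussianReal (a i) v) =
      (Measure.pi fun _ : ι => gaussianReal 0 v).withDensity
        (fun x => ENNReal.ofReal (Real.exp ((∑ i, a i / v * x i) - (∑ i, a i ^ 2 / v) / 2))) := by
  have (i : ι) : SigmaFinite ((gaussianReal 0 v).withDensity
      (fun x => ENNReal.ofReal (Real.exp (a i * x / v - a i ^ 2 / (2 * v))))) := by
    rw [← gaussianReal_eq_withDensity (a i) hv]; infer_instance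
  have h := pi_withDensity (fun _ : ι => gaussianReal 0 v)
    (fun i x => ENNReal.ofReal (Real.exp (a i * x / v - a i ^ 2 / (2 * v)))) (fun i => by fun_prop)
  simp_rw [← gaussianReal_eq_withDensity _ hv] at h
  rw [h]
  congr 1
  ext x
  rw [← ENNReal.ofReal_prod_of_nonneg fun _ _ => (Real.exp_pos _).le, ← Real.exp_sum,
    Finset.sum_sub_distrib, Finset.sum_div]
  congr 3
  · exact Finset.sum_congr rfl fun i _ => by ring
  · exact Finset.sum_congr rfl fun i _ => by ring

theorem map_sum_mul_pi_gaussianReal {ι : Type*} [Fintype ι] (b : ι → ℝ) (v : ℝ≥0) :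
    (Measure.pi fun _ : ι => gaussianReal 0 v).map (fun x => ∑ i, b i * x i) =
      gaussianReal 0 ((∑ i, b i ^ 2).toNNReal * v) := by
  have hm : Measurable fun x : ι → ℝ => ∑ i, b i * x i :=
    Finset.measurable_sum _ fun i _ => (measurable_pi_apply i).const_mul _
  have := Measure.isProbabilityMeasure_map (μ := Measure.pi fun _ : ι => gaussianReal 0 v)
    hm.aemeasurable
  refine Measure.ext_of_charFun ?_
  ext t
  rw [charFun_gaussianReal, charFun_apply_real, integral_map hm.aemeasurable (by fun_prop)]
  have : ∀ x : ι → ℝ, Complex.exp (t * ((∑ i, b i * x i : ℝ) : ℂ) * Complex.I) =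
      ∏ i, Complex.exp ((t * b i : ℝ) * (x i : ℂ) * Complex.I) := by
    intro x
    rw [← Complex.exp_sum]
    congr 1
    push_cast
    rw [Finset.mul_sum, Finset.sum_mul]
    exact Finset.sum_congr rfl fun i _ => by ring
  simp_rw [this]
  rw [integral_fintype_prod_eq_prod
    (f := fun i (y : ℝ) => Complex.exp ((t * b i : ℝ) * (y : ℂ) * Complex.I))]
  simp_rw [← charFun_apply_real, charFun_gaussianReal]
  rw [← Complex.exp_sum]
  congr 1
  have hnn : (0 : ℝ) ≤ ∑ i, b i ^ 2 := Finset.sum_nonneg fun i _ => sq_nonneg _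
  simp only [NNReal.coe_mul, Real.coe_toNNReal _ hnn]
  push_cast
  simp only [mul_zero, zero_mul, zero_sub, Finset.sum_neg_distrib, ← Finset.sum_div]
  rw [Finset.sum_mul, Finset.sum_mul]
  congr 2
  exact Finset.sum_congr rfl fun i _ => by ring

theorem integral_abs_gaussianReal (v : ℝ≥0) :
    ∫ x, |x| ∂gaussianReal 0 v = Real.sqrt (2 * v / Real.pi) := by
  rcases eq_or_ne v 0 with rfl | hv
  · simp
  have hv' : (0 : ℝ) < v := by positivity
  rw [integral_gaussianReal_eq_integral_smul hv]
  have h1 : ∀ x : ℝ, gaussianPDFReal 0 v x • |x| =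
      (fun y => (Real.sqrt (2 * Real.pi * v))⁻¹ * (y ^ (1 : ℝ) * Real.exp (-(1 / (2 * v)) * y ^ (2 : ℝ)))) |x| := by
    intro x
    simp only [gaussianPDFReal, smul_eq_mul, sub_zero, Real.rpow_one, Real.rpow_ofNat, sq_abs]
    rw [show -(1 / (2 * (v : ℝ))) * x ^ 2 = -x ^ 2 / (2 * v) by ring]
    ring
  simp_rw [h1]
  rw [integral_comp_abs (f := fun y => (Real.sqrt (2 * Real.pi * v))⁻¹ *
    (y ^ (1 : ℝ) * Real.exp (-(1 / (2 * v)) * y ^ (2 : ℝ)))), integral_const_mul,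
    integral_rpow_mul_exp_neg_mul_rpow (by norm_num) (by norm_num) (by positivity)]
  norm_num
  have h2 := Real.sq_sqrt (show (0 : ℝ) ≤ 2 by norm_num)
  have hv2 := Real.sq_sqrt hv'.le
  have : Real.sqrt v ≠ 0 := (Real.sqrt_pos.2 hv').ne'
  have : Real.sqrt Real.pi ≠ 0 := (Real.sqrt_pos.2 Real.pi_pos).ne'
  rw [Real.rpow_neg_one]
  field_simp
  nlinarith

theorem ofReal_exp_integral_le {α : Type*} [MeasurableSpace α] {μ : Measure α}
    [IsProbabilityMeasure μ] {f : α → ℝ} (hf : Integrable f μ) :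
    ENNReal.ofReal (Real.exp (∫ x, f x ∂μ)) ≤ ∫⁻ x, ENNReal.ofReal (Real.exp (f x)) ∂μ := by
  by_cases htop : ∫⁻ x, ENNReal.ofReal (Real.exp (f x)) ∂μ = ⊤
  · rw [htop]; exact le_top
  have hmeas : AEStronglyMeasurable (fun x => Real.exp (f x)) μ :=
    Real.continuous_exp.comp_aestronglyMeasurable hf.1
  have hint : Integrable (fun x => Real.exp (f x)) μ :=
    ⟨hmeas, (hasFiniteIntegral_iff_ofReal (.of_forall fun x => (Real.exp_pos _).le)).2
      (lt_top_iff_ne_top.2 htop)⟩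
  rw [← ofReal_integral_eq_lintegral_ofReal hint (.of_forall fun x => (Real.exp_pos _).le)]
  exact ENNReal.ofReal_le_ofReal (convexOn_exp.map_integral_le
    Real.continuous_exp.continuousOn isClosed_univ (by simp) hf hint)

/-- Trades the square root for a bound whose exponent is linear in `u`, so that Jensen can later be
applied to a random `u`. The price is the factor `1/4`. -/
theorem quarter_mul_exp_le {u : ℝ} (hu : 0 ≤ u) :
    1 / 4 * Real.exp (-(2 / Real.pi) * u) ≤ Real.exp (-(u / 2) - Real.sqrt (2 * u / Real.pi)) := by
  have hlog : (1.386 : ℝ) ≤ Real.log 4 := by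
    rw [show (4 : ℝ) = 2 ^ 2 by norm_num, Real.log_pow]
    have := Real.log_two_gt_d9
    push_cast
    linarith
  have h4 : (1 / 4 : ℝ) = Real.exp (-Real.log 4) := by
    rw [Real.exp_neg, Real.exp_log (by norm_num)]; norm_num
  rw [h4, ← Real.exp_add, Real.exp_le_exp]
  have hpi := Real.pi_gt_d4
  have hpi' := Real.pi_lt_d4
  set q := 2 / Real.pi with hq
  have hq1 : (0.636 : ℝ) ≤ q := by rw [hq, le_div_iff₀ Real.pi_pos]; linarith
  have hq2 : q ≤ 0.637 := by rw [hq, div_le_iff₀ Real.pi_pos]; linarith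
  -- The constants lie below `2/π - 1/2` and `log 4`; the inequality is AM-GM, as `4 * 0.136 * 1.386
  -- > 0.637`.
  have hs : Real.sqrt (2 * u / Real.pi) ≤ 0.136 * u + 1.386 := by
    refine Real.sqrt_le_iff.2 ⟨by positivity, ?_⟩
    rw [show 2 * u / Real.pi = q * u by rw [hq]; ring]
    nlinarith [sq_nonneg (0.136 * u - 1.386), mul_le_mul_of_nonneg_right hq2 hu]
  nlinarith [mul_le_mul_of_nonneg_right hq1 hu]

/-- Relative to the centred Gaussian, the two densities are `exp (± A - u/2)`, both at least `exp
(-u/2 - |A|)`. As `B` and `C` cover the space, the sum dominates the full integral of this minorant,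
and Jensen applies with `A ∼ N(0, u)`. -/
theorem le_pi_gaussianReal_add_pi_gaussianReal {ι : Type*} [Fintype ι] (a : ι → ℝ) {v : ℝ≥0}
    (hv : v ≠ 0) {B C : Set (ι → ℝ)} (hB : MeasurableSet B) (hC : MeasurableSet C)
    (hBC : B ∪ C = Set.univ) :
    ENNReal.ofReal (1 / 4 * Real.exp (-(2 / Real.pi) * ∑ i, a i ^ 2 / v)) ≤
      Measure.pi (fun i => gaussianReal (a i) v) B +
        Measure.pi (fun i => gaussianReal (-a i) v) C := by
  have hv' : (v : ℝ) ≠ 0 := by exact_mod_cast hv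
  set u := ∑ i, a i ^ 2 / v with hu_def
  set γ := Measure.pi fun _ : ι => gaussianReal 0 v
  have hu : 0 ≤ u := Finset.sum_nonneg fun i _ => by positivity
  let A : (ι → ℝ) → ℝ := fun x => ∑ i, a i / v * x i
  have hA : Measurable A := Finset.measurable_sum _ fun i _ => (measurable_pi_apply i).const_mul _
  have hmap : γ.map A = gaussianReal 0 u.toNNReal := by
    rw [map_sum_mul_pi_gaussianReal]
    congr 1
    rw [← Real.toNNReal_coe (r := v), ← Real.toNNReal_mul (Finset.sum_nonneg fun i _ => sq_nonneg _),
      Finset.sum_mul, hu_def, Real.toNNReal_coe]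
    congr 1
    exact Finset.sum_congr rfl fun i _ => by field_simp
  have habs : ∫ x, |A x| ∂γ = Real.sqrt (2 * u / Real.pi) := by
    rw [← integral_map (f := fun y : ℝ => |y|) hA.aemeasurable (by fun_prop), hmap,
      integral_abs_gaussianReal, Real.coe_toNNReal _ hu]
  have hint : Integrable (fun x => |A x|) γ := by
    have : Integrable (fun y : ℝ => |y|) (γ.map A) := by
      rw [hmap]
      exact ((memLp_id_gaussianReal 1).integrable (by simp)).abs
    exact this.comp_measurable hA
  let F : (ι → ℝ) → ℝ≥0∞ := fun x => ENNReal.ofReal (Real.exp (-(u / 2) - |A x|))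
  have h1 : ∫⁻ x in B, F x ∂γ ≤ Measure.pi (fun i => gaussianReal (a i) v) B := by
    rw [pi_gaussianReal_eq_withDensity _ hv, withDensity_apply _ hB]
    refine lintegral_mono fun x => ENNReal.ofReal_le_ofReal (Real.exp_le_exp.2 ?_)
    have := neg_abs_le (A x)
    change -(u / 2) - |A x| ≤ A x - u / 2
    linarith
  have h2 : ∫⁻ x in C, F x ∂γ ≤ Measure.pi (fun i => gaussianReal (-a i) v) C := by
    rw [pi_gaussianReal_eq_withDensity _ hv, withDensity_apply _ hC]
    refine lintegral_mono fun x => ENNReal.ofReal_le_ofReal (Real.exp_le_exp.2 ?_)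
    have := le_abs_self (A x)
    simp only [neg_sq, neg_div, neg_mul, Finset.sum_neg_distrib]
    change -(u / 2) - |A x| ≤ -A x - u / 2
    linarith
  calc _ ≤ ENNReal.ofReal (Real.exp (∫ x, (-(u / 2) - |A x|) ∂γ)) := by
        refine ENNReal.ofReal_le_ofReal ?_
        rw [integral_sub (integrable_const _) hint, habs]
        simpa using quarter_mul_exp_le hu
    _ ≤ ∫⁻ x, F x ∂γ := ofReal_exp_integral_le ((integrable_const _).sub hint)
    _ = ∫⁻ x in B ∪ C, F x ∂γ := by rw [hBC, setLIntegral_univ]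
    _ ≤ _ := (lintegral_union_le _ _ _).trans (add_le_add h1 h2)

theorem pi_gaussianReal_map_add {ι : Type*} [Fintype ι] (a m : ι → ℝ) (v : ℝ≥0) :
    (Measure.pi fun i => gaussianReal (a i) v).map (fun x i => m i + x i) =
      Measure.pi fun i => gaussianReal (a i + m i) v := by
  have (i : ι) : SigmaFinite ((gaussianReal (a i) v).map (m i + ·)) := by
    rw [gaussianReal_map_const_add]; infer_instance
  rw [Measure.pi_map_pi (f := fun i y => m i + y) fun i => by fun_prop]
  simp_rw [gaussianReal_map_const_add]

/-- Translating by the midpoint of `a` and `b` reduces to opposite means. -/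
theorem le_pi_gaussianReal_add_pi_gaussianReal' {ι : Type*} [Fintype ι] (a b : ι → ℝ) {v : ℝ≥0}
    (hv : v ≠ 0) {B C : Set (ι → ℝ)} (hB : MeasurableSet B) (hC : MeasurableSet C)
    (hBC : B ∪ C = Set.univ) :
    ENNReal.ofReal (1 / 4 * Real.exp (-(2 / Real.pi) * ∑ i, ((a i - b i) / 2) ^ 2 / v)) ≤
      Measure.pi (fun i => gaussianReal (a i) v) B +
        Measure.pi (fun i => gaussianReal (b i) v) C := by
  have hm : Measurable fun (x : ι → ℝ) i => (a i + b i) / 2 + x i := by fun_prop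
  have ha : Measure.pi (fun i => gaussianReal (a i) v) =
      (Measure.pi fun i => gaussianReal ((a i - b i) / 2) v).map
        (fun x i => (a i + b i) / 2 + x i) := by
    rw [pi_gaussianReal_map_add]
    congr! 3
    ring
  have hb : Measure.pi (fun i => gaussianReal (b i) v) =
      (Measure.pi fun i => gaussianReal (-((a i - b i) / 2)) v).map
        (fun x i => (a i + b i) / 2 + x i) := by
    rw [pi_gaussianReal_map_add]
    congr! 3
    ring
  rw [ha, hb, Measure.map_apply hm hB, Measure.map_apply hm hC]
  exact le_pi_gaussianReal_add_pi_gaussianReal _ hv (hm hB) (hm hC)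
    (by rw [← Set.preimage_union, hBC, Set.preimage_univ])

/-! ### Samples with random design. -/

/-- The law of `(X, r(X) + ε)` for a design law `μ` and independent noise `ε ∼ N(0, v)`. -/
noncomputable def observationLaw {E : Type*} [MeasurableSpace E] (μ : Measure E) (v : ℝ≥0)
    (r : E → ℝ) : Measure (E × ℝ) :=
  (μ.prod (gaussianReal 0 v)).map (fun p => (p.1, r p.1 + p.2))

section

variable {E : Type*} [MeasurableSpace E] {μ : Measure E} [IsProbabilityMeasure μ] {v : ℝ≥0}

theorem isProbabilityMeasure_observationLaw {r : E → ℝ} (hr : Measurable r) :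
    IsProbabilityMeasure (observationLaw μ v r) :=
  Measure.isProbabilityMeasure_map (by fun_prop)

theorem pi_gaussianReal_apply_eq_preimage {ι : Type*} [Fintype ι] (r : E → ℝ) (x : ι → E)
    {B : Set (ι → E × ℝ)} (hB : MeasurableSet B) :
    Measure.pi (fun i => gaussianReal (r (x i)) v) {e | (fun i => (x i, e i)) ∈ B} =
      Measure.pi (fun _ : ι => gaussianReal 0 v)
        (Prod.mk x ⁻¹' ((fun (p : (ι → E) × (ι → ℝ)) i => (p.1 i, r (p.1 i) + p.2 i)) ⁻¹' B)) := by
  have hx : Measurable fun (e : ι → ℝ) i => (x i, e i) := by fun_prop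
  have hs : Measurable fun (e : ι → ℝ) i => r (x i) + e i := by fun_prop
  have := pi_gaussianReal_map_add (fun _ => 0) (fun i => r (x i)) v
  simp only [zero_add] at this
  rw [← this]
  exact Measure.map_apply hs (hx hB)

theorem measurable_pi_gaussianReal_apply {ι : Type*} [Fintype ι] {r : E → ℝ} (hr : Measurable r)
    {B : Set (ι → E × ℝ)} (hB : MeasurableSet B) :
    Measurable fun x : ι → E =>
      Measure.pi (fun i => gaussianReal (r (x i)) v) {e | (fun i => (x i, e i)) ∈ B} := by
  simp_rw [pi_gaussianReal_apply_eq_preimage r _ hB]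
  have hS : Measurable fun (p : (ι → E) × (ι → ℝ)) i => (p.1 i, r (p.1 i) + p.2 i) := by fun_prop
  exact measurable_measure_prodMk_left (hS hB)

/-- Conditioning on the design points leaves independent Gaussian responses with means `r (x i)`. -/
theorem pi_observationLaw_apply {ι : Type*} [Fintype ι] {r : E → ℝ} (hr : Measurable r)
    {B : Set (ι → E × ℝ)} (hB : MeasurableSet B) :
    Measure.pi (fun _ : ι => observationLaw μ v r) B =
      ∫⁻ x, Measure.pi (fun i => gaussianReal (r (x i)) v) {e | (fun i => (x i, e i)) ∈ B}
        ∂(Measure.pi fun _ : ι => μ) := by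
  have := isProbabilityMeasure_observationLaw (μ := μ) (v := v) hr
  have (_ : ι) : SigmaFinite ((μ.prod (gaussianReal 0 v)).map fun p => (p.1, r p.1 + p.2)) := by
    change SigmaFinite (observationLaw μ v r); infer_instance
  have hT : Measurable fun (p : ι → E × ℝ) i => ((p i).1, r (p i).1 + (p i).2) := by fun_prop
  unfold observationLaw
  rw [← Measure.pi_map_pi (f := fun _ (p : E × ℝ) => (p.1, r p.1 + p.2))
    (fun _ => by fun_prop), Measure.map_apply hT hB,
    ← ((measurePreserving_arrowProdEquivProdArrow E ℝ ι (fun _ => μ)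
      (fun _ => gaussianReal 0 v)).symm _).measure_preimage_equiv, Measure.prod_apply
      ((MeasurableEquiv.measurable _) (hT hB))]
  exact lintegral_congr fun x => (pi_gaussianReal_apply_eq_preimage r x hB).symm

/-- The fixed-design bound holds for each `x`; a second Jensen inequality replaces the random
exponent by its mean over the design. -/
theorem le_pi_observationLaw_add_pi_observationLaw {ι : Type*} [Fintype ι] (hv : v ≠ 0)
    {r s : E → ℝ} (hr : Measurable r) (hs : Measurable s)
    (hint : Integrable (fun x => ((r x - s x) / 2) ^ 2) μ) {κ : ℝ}
    (hκ : ∫ x, ((r x - s x) / 2) ^ 2 ∂μ ≤ κ)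
    {B C : Set (ι → E × ℝ)} (hB : MeasurableSet B) (hC : MeasurableSet C)
    (hBC : B ∪ C = Set.univ) :
    ENNReal.ofReal (1 / 4 * Real.exp (-(2 / Real.pi) * (Fintype.card ι * κ / v))) ≤
      Measure.pi (fun _ : ι => observationLaw μ v r) B +
        Measure.pi (fun _ : ι => observationLaw μ v s) C := by
  let U : (ι → E) → ℝ := fun x => ∑ i, ((r (x i) - s (x i)) / 2) ^ 2 / v
  have hUi (i : ι) : Integrable (fun x : ι → E => ((r (x i) - s (x i)) / 2) ^ 2 / v)
      (Measure.pi fun _ : ι => μ) :=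
    (measurePreserving_eval (fun _ : ι => μ) i).integrable_comp_of_integrable (hint.div_const _)
  have hU : Integrable U (Measure.pi fun _ : ι => μ) := integrable_finsetSum _ fun i _ => hUi i
  have hUle : ∫ x, U x ∂(Measure.pi fun _ : ι => μ) ≤ Fintype.card ι * κ / v := by
    rw [integral_finsetSum _ fun i _ => hUi i]
    have (i : ι) : ∫ x : ι → E, ((r (x i) - s (x i)) / 2) ^ 2 / v ∂(Measure.pi fun _ : ι => μ) ≤
        κ / v := by
      rw [integral_div]
      refine div_le_div_of_nonneg_right ?_ v.2
      rw [integral_comp_eval (μ := fun _ : ι => μ) (i := i)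
        (f := fun y => ((r y - s y) / 2) ^ 2) hint.1]
      exact hκ
    calc _ ≤ ∑ _i : ι, κ / v := Finset.sum_le_sum fun i _ => this i
      _ = _ := by simp [mul_div_assoc]
  have hpi : 0 ≤ 2 / Real.pi := by positivity
  have hpt (x : ι → E) : ENNReal.ofReal (1 / 4) * ENNReal.ofReal (Real.exp (-(2 / Real.pi) * U x)) ≤
      Measure.pi (fun i => gaussianReal (r (x i)) v) {e | (fun i => (x i, e i)) ∈ B} +
      Measure.pi (fun i => gaussianReal (s (x i)) v) {e | (fun i => (x i, e i)) ∈ C} := by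
    have hx : Measurable fun (e : ι → ℝ) i => (x i, e i) := by fun_prop
    rw [← ENNReal.ofReal_mul (by norm_num)]
    refine le_pi_gaussianReal_add_pi_gaussianReal' _ _ hv (hx hB) (hx hC) ?_
    exact Set.eq_univ_of_forall fun e => Set.eq_univ_iff_forall.1 hBC fun i => (x i, e i)
  rw [pi_observationLaw_apply hr hB, pi_observationLaw_apply hs hC]
  rw [← lintegral_add_left (measurable_pi_gaussianReal_apply hr hB)]
  refine le_trans ?_ (lintegral_mono hpt)
  rw [lintegral_const_mul' _ _ ENNReal.ofReal_ne_top, ENNReal.ofReal_mul (by norm_num)]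
  refine mul_le_mul_right ?_ _
  refine le_trans ?_ (ofReal_exp_integral_le (hU.const_mul _))
  refine ENNReal.ofReal_le_ofReal (Real.exp_le_exp.2 ?_)
  rw [integral_const_mul]
  nlinarith [mul_le_mul_of_nonneg_left hUle hpi]

end

/-! ### Averaging over sign patterns. -/

/-- The profile `g` multiplied on each cell `idx ⁻¹' {j}` by the sign encoded by `c j`. -/
def signedProfile {E ι : Type*} (idx : E → ι) (g : E → ℝ) (c : ι → Bool) (x : E) : ℝ :=
  (if c (idx x) then 1 else -1) * g x

theorem signedProfile_sub_signedProfile_update {E ι : Type*} [DecidableEq ι] {idx : E → ι}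
    {g : E → ℝ} (c : ι → Bool) (j : ι) (x : E) :
    ((signedProfile idx g c x - signedProfile idx g (Function.update c j (!c j)) x) / 2) ^ 2 =
      (idx ⁻¹' {j}).indicator (fun y => g y ^ 2) x := by
  by_cases h : idx x = j
  · subst h
    rw [Set.indicator_of_mem (by simp)]
    cases hc : c (idx x)
    · simp [signedProfile, hc]
      ring
    · simp [signedProfile, hc]
  · rw [Set.indicator_of_notMem (by simpa using h)]
    simp [signedProfile, Function.update_of_ne h]

section

variable {E ι : Type*} [MeasurableSpace E] [MeasurableSpace ι] [DiscreteMeasurableSpace ι]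
  {idx : E → ι} {g : E → ℝ}

theorem measurable_signedProfile (hidx : Measurable idx) (hg : Measurable g) (c : ι → Bool) :
    Measurable (signedProfile idx g c) :=
  ((Measurable.of_discrete (f := fun j => if c j then (1 : ℝ) else -1)).comp hidx).mul hg

variable [DecidableEq ι]

theorem exists_sign_le_measure_abs_sub [Fintype ι] {μ : Measure E} [IsProbabilityMeasure μ]
    {v : ℝ≥0} (hv : v ≠ 0) (hidx : Measurable idx) (hg : Measurable g)
    {n : ℕ} {κ t : ℝ} {p : ℝ≥0∞}
    (hint : Integrable (fun x => g x ^ 2) μ)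
    (hκ : ∀ j, ∫ x in idx ⁻¹' {j}, g x ^ 2 ∂μ ≤ κ)
    (hp : p ≤ μ {x | t ≤ g x})
    {rhat : E → (Fin n → E × ℝ) → ℝ} (hrhat : Measurable (Function.uncurry rhat)) :
    ∃ c : ι → Bool,
      ENNReal.ofReal (1 / 4 * Real.exp (-(2 / Real.pi) * (n * κ / v))) * p ≤
      2 * (μ.prod (Measure.pi fun _ => observationLaw μ v (signedProfile idx g c)))
        {ω | t ≤ |rhat ω.1 ω.2 - signedProfile idx g c ω.1|} := by
  set q := ENNReal.ofReal (1 / 4 * Real.exp (-(2 / Real.pi) * (n * κ / v)))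
  have hr := measurable_signedProfile hidx hg
  have hprob (c : ι → Bool) : IsProbabilityMeasure (observationLaw μ v (signedProfile idx g c)) :=
    isProbabilityMeasure_observationLaw (hr c)
  let P (c : ι → Bool) : Measure (Fin n → E × ℝ) :=
    Measure.pi fun _ => observationLaw μ v (signedProfile idx g c)
  let D (c : ι → Bool) : Set (E × (Fin n → E × ℝ)) :=
    {ω | t ≤ |rhat ω.1 ω.2 - signedProfile idx g c ω.1|}
  have hD (c : ι → Bool) : MeasurableSet (D c) := by
    have h1 : Measurable fun ω : E × (Fin n → E × ℝ) =>
        |Function.uncurry rhat ω - signedProfile idx g c ω.1| :=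
      (hrhat.sub ((hr c).comp measurable_fst)).abs
    exact measurableSet_le measurable_const h1
  let φ (c : ι → Bool) (x : E) : ℝ≥0∞ := P c (Prod.mk x ⁻¹' D c)
  have hφ (c : ι → Bool) : Measurable (φ c) := measurable_measure_prodMk_left (hD c)
  have hpair (c : ι → Bool) (x : E) (hx : t ≤ g x) :
      q ≤ φ c x + φ (Function.update c (idx x) (!c (idx x))) x := by
    have hsq := signedProfile_sub_signedProfile_update (g := g) (idx := idx) c (idx x)
    have hset : MeasurableSet (idx ⁻¹' {idx x}) := hidx (MeasurableSet.of_discrete)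
    have := le_pi_observationLaw_add_pi_observationLaw (μ := μ) (ι := Fin n) hv (hr c)
      (hr (Function.update c (idx x) (!c (idx x)))) (κ := κ)
      (B := Prod.mk x ⁻¹' D c) (C := Prod.mk x ⁻¹' D (Function.update c (idx x) (!c (idx x))))
      (by simp_rw [hsq]; exact hint.indicator hset)
      (by simp_rw [hsq]; rw [integral_indicator hset]; exact hκ _)
      (measurable_prodMk_left (hD _)) (measurable_prodMk_left (hD _)) ?_
    · rwa [Fintype.card_fin] at this
    -- A prediction closer than `t` to both `g x` and `-g x` would force `g x < t`.
    · refine Set.eq_univ_of_forall fun y => ?_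
      by_contra hy
      simp only [D, Set.mem_union, Set.mem_preimage, Set.mem_ofPred_eq, not_or, not_le, abs_lt,
        signedProfile, Function.update_self] at hy
      obtain ⟨⟨h1, h2⟩, h3, h4⟩ := hy
      cases hc : c (idx x) <;> simp [hc] at h1 h2 h3 h4 <;> linarith
  have hsum (x : E) : Fintype.card (ι → Bool) * ({x | t ≤ g x}.indicator (fun _ => q) x) ≤
      ∑ c, 2 * φ c x := by
    by_cases hx : t ≤ g x
    · rw [Set.indicator_of_mem (by exact hx)]
      -- For fixed `x` the flip permutes the sign patterns, so summing the paired bounds counts each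
      -- `φ c x` twice.
      have hinv : Function.Involutive
          fun c : ι → Bool => Function.update c (idx x) (!c (idx x)) := by
        intro c; simp
      calc _ = ∑ _c : ι → Bool, q := by simp
        _ ≤ ∑ c, (φ c x + φ (Function.update c (idx x) (!c (idx x))) x) :=
          Finset.sum_le_sum fun c _ => hpair c x hx
        _ = _ := by
          rw [Finset.sum_add_distrib, hinv.bijective.sum_comp (fun c => φ c x), ← two_mul,
            Finset.mul_sum]
    · rw [Set.indicator_of_notMem (by exact hx)]
      simp
  by_contra! hcon
  have hlt : ∑ c, 2 * (μ.prod (P c)) (D c) < ∑ _c : ι → Bool, q * p :=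
    ENNReal.sum_lt_sum_of_nonempty Finset.univ_nonempty fun c _ => hcon c
  refine absurd hlt (not_lt.2 ?_)
  calc ∑ _c : ι → Bool, q * p = Fintype.card (ι → Bool) * (q * p) := by simp
    _ ≤ Fintype.card (ι → Bool) * (q * μ {x | t ≤ g x}) := by gcongr
    _ = ∫⁻ x, Fintype.card (ι → Bool) * ({x | t ≤ g x}.indicator (fun _ => q) x) ∂μ := by
        rw [lintegral_const_mul' _ _ (ENNReal.natCast_ne_top _),
          lintegral_indicator_const (measurableSet_le measurable_const hg)]
    _ ≤ ∫⁻ x, ∑ c, 2 * φ c x ∂μ := lintegral_mono hsum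
    _ = ∑ c, 2 * (μ.prod (P c)) (D c) := by
        rw [lintegral_finsetSum _ fun c _ => (hφ c).const_mul _]
        refine Finset.sum_congr rfl fun c _ => ?_
        rw [lintegral_const_mul _ (hφ c), Measure.prod_apply (hD c)]

end

/-! ### Distance to the grid in one coordinate. -/

/-- The distance from `s` to the grid `hℤ`. -/
noncomputable def gridDist (h s : ℝ) : ℝ := |s - h * round (s / h)|

theorem gridDist_nonneg (h s : ℝ) : 0 ≤ gridDist h s := abs_nonneg _

theorem gridDist_le {h : ℝ} (hh : 0 < h) (s : ℝ) (k : ℤ) : gridDist h s ≤ |s - h * k| := by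
  have key (m : ℤ) : |s - h * m| = h * |s / h - m| := by
    rw [← abs_of_pos hh, ← abs_mul, abs_of_pos hh, mul_sub, mul_div_cancel₀ _ hh.ne']
  rw [gridDist, key, key]
  exact mul_le_mul_of_nonneg_left (round_le _ _) hh.le

theorem gridDist_le_add {h : ℝ} (hh : 0 < h) (s t : ℝ) :
    gridDist h s ≤ gridDist h t + |s - t| := by
  refine (gridDist_le hh s (round (t / h))).trans ?_
  rw [gridDist, add_comm]
  exact abs_sub_le _ _ _

/-- A grid point lies between `s` and `t`, and each distance to the grid is at most the distance to
that point. -/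
theorem gridDist_add_le_of_floor_lt {h : ℝ} (hh : 0 < h) {s t : ℝ}
    (hst : ⌊s / h⌋₊ < ⌊t / h⌋₊) : gridDist h s + gridDist h t ≤ |s - t| := by
  set k := ⌊t / h⌋₊
  have h1 : s < h * k := by
    have := (Nat.floor_lt' (by omega)).1 hst
    rwa [div_lt_iff₀' hh] at this
  have h2 : h * k ≤ t := by
    have : (k : ℝ) ≤ t / h := (Nat.le_floor_iff' (by omega)).1 le_rfl
    rwa [le_div_iff₀' hh] at this
  have h3 := gridDist_le hh s k
  have h4 := gridDist_le hh t k
  push_cast at h3 h4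
  rw [abs_of_neg (by linarith)] at h3
  rw [abs_of_nonneg (by linarith)] at h4
  rw [abs_of_neg (by linarith)]
  linarith

theorem gridDist_add_le_of_floor_ne {h : ℝ} (hh : 0 < h) {s t : ℝ}
    (hst : ⌊s / h⌋₊ ≠ ⌊t / h⌋₊) : gridDist h s + gridDist h t ≤ |s - t| := by
  rcases lt_or_gt_of_ne hst with hlt | hlt
  · exact gridDist_add_le_of_floor_lt hh hlt
  · rw [add_comm, abs_sub_comm]
    exact gridDist_add_le_of_floor_lt hh hlt

theorem le_gridDist {h s : ℝ} {k : ℕ} (hh : 0 < h)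
    (hs : s ∈ Set.Icc (h * k + h / 4) (h * k + 3 * h / 4)) : h / 4 ≤ gridDist h s := by
  obtain ⟨h1, h2⟩ := hs
  rw [gridDist]
  rcases le_or_gt (round (s / h)) (k : ℤ) with hm | hm
  · have hm' : ((round (s / h) : ℤ) : ℝ) ≤ k := by exact_mod_cast hm
    rw [le_abs]; left
    nlinarith
  · have hm' : (k : ℝ) + 1 ≤ (round (s / h) : ℤ) := by exact_mod_cast hm
    rw [le_abs]; right
    nlinarith

/-- Positivity of `t` excludes the endpoint `h * N`, whose floor would be `N`; hence reducing
indices modulo `N` merges no relevant cells of the cube. -/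
theorem mem_Icc_of_le_gridDist {h s t : ℝ} {N : ℕ} (hh : 0 < h)
    (hs : s ∈ Set.Icc 0 (h * N)) (ht : 0 < t) (hts : t ≤ gridDist h s) :
    ⌊s / h⌋₊ < N ∧ s ∈ Set.Icc (h * ⌊s / h⌋₊ + t) (h * (⌊s / h⌋₊ + 1) - t) := by
  set k := ⌊s / h⌋₊ with hk
  have h1 : h * k ≤ s := by
    have : (k : ℝ) ≤ s / h := Nat.floor_le (div_nonneg hs.1 hh.le)
    rwa [le_div_iff₀' hh] at this
  have h2 : s < h * (k + 1) := by
    have : s / h < k + 1 := Nat.lt_floor_add_one _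
    rwa [div_lt_iff₀' hh] at this
  have h3 := hts.trans (gridDist_le hh s k)
  have h4 := hts.trans (gridDist_le hh s (k + 1))
  have h5 := hts.trans (gridDist_le hh s N)
  push_cast at h3 h4 h5
  rw [abs_of_nonneg (by linarith)] at h3
  rw [abs_of_neg (by linarith)] at h4
  rw [abs_of_nonpos (by linarith [hs.2])] at h5
  refine ⟨?_, by linarith, by linarith⟩
  by_contra! hN
  have : (N : ℝ) ≤ k := by exact_mod_cast hN
  nlinarith

/-! ### Cells and the Lipschitz sign functions. -/

/-- The sup-norm distance from `x` to the walls of the grid of cells of side `h`. -/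
noncomputable def wallDist (d : ℕ) (h : ℝ) (x : EuclideanSpace ℝ (Fin d)) : ℝ :=
  ⨅ i, gridDist h (x i)

/-- The index of the cell of side `h` that contains `x`, with coordinates taken modulo `N`. -/
noncomputable def cellIndex (d N : ℕ) [NeZero N] (h : ℝ) (x : EuclideanSpace ℝ (Fin d)) :
    Fin d → Fin N :=
  fun i => Fin.ofNat N ⌊x i / h⌋₊

section

variable {d N : ℕ} {h : ℝ}

theorem wallDist_le (x : EuclideanSpace ℝ (Fin d)) (i : Fin d) :
    wallDist d h x ≤ gridDist h (x i) :=
  ciInf_le (Set.finite_range _).bddBelow i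

theorem wallDist_nonneg (x : EuclideanSpace ℝ (Fin d)) : 0 ≤ wallDist d h x :=
  Real.iInf_nonneg fun _ => gridDist_nonneg _ _

theorem le_wallDist_iff [NeZero d] {x : EuclideanSpace ℝ (Fin d)} {t : ℝ} :
    t ≤ wallDist d h x ↔ ∀ i, t ≤ gridDist h (x i) :=
  le_ciInf_iff (Set.finite_range _).bddBelow

theorem abs_sub_apply_le_dist (x y : EuclideanSpace ℝ (Fin d)) (i : Fin d) :
    |x i - y i| ≤ dist x y := by
  rw [dist_eq_norm]
  exact PiLp.norm_apply_le (x - y) i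

theorem wallDist_le_add_dist [NeZero d] (hh : 0 < h) (x y : EuclideanSpace ℝ (Fin d)) :
    wallDist d h x ≤ wallDist d h y + dist x y := by
  rw [← sub_le_iff_le_add, le_wallDist_iff]
  intro i
  linarith [wallDist_le (h := h) x i, gridDist_le_add hh (x i) (y i), abs_sub_apply_le_dist x y i]

theorem lipschitzWith_wallDist [NeZero d] (hh : 0 < h) : LipschitzWith 1 (wallDist d h) :=
  LipschitzWith.of_le_add fun x y => wallDist_le_add_dist hh x y

/-- With equal floors the signs agree and the Lipschitz bound for `wallDist` suffices. Otherwise a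
wall separates the points, and the sum of their wall distances is at most their distance, whatever
the signs. -/
theorem lipschitzWith_signedProfile [NeZero d] [NeZero N] (hh : 0 < h)
    (c : (Fin d → Fin N) → Bool) :
    LipschitzWith 1 (signedProfile (cellIndex d N h) (wallDist d h) c) := by
  refine LipschitzWith.of_dist_le_mul fun x y => ?_
  rw [NNReal.coe_one, one_mul, Real.dist_eq]
  have habs (z : EuclideanSpace ℝ (Fin d)) :
      |signedProfile (cellIndex d N h) (wallDist d h) c z| = wallDist d h z := by
    rw [signedProfile, abs_mul, abs_of_nonneg (wallDist_nonneg z)]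
    split_ifs <;> simp
  by_cases hxy : ∀ i, ⌊x i / h⌋₊ = ⌊y i / h⌋₊
  · have : cellIndex d N h x = cellIndex d N h y := by
      funext i
      simp [cellIndex, hxy i]
    rw [signedProfile, signedProfile, this, ← mul_sub, abs_mul]
    have h1 : |(if c (cellIndex d N h y) then (1 : ℝ) else -1)| = 1 := by split_ifs <;> simp
    rw [h1, one_mul, abs_le]
    have h2 := wallDist_le_add_dist hh x y
    have h3 := wallDist_le_add_dist hh y x
    rw [dist_comm] at h3
    constructor <;> linarith
  · push Not at hxy
    obtain ⟨i, hi⟩ := hxy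
    refine (abs_sub _ _).trans ?_
    rw [habs, habs]
    linarith [wallDist_le (h := h) x i, wallDist_le (h := h) y i,
      gridDist_add_le_of_floor_ne hh hi, abs_sub_apply_le_dist x y i]

theorem measurable_cellIndex [NeZero N] : Measurable (cellIndex d N h) := by
  refine measurable_pi_lambda _ fun i => ?_
  have h1 : Measurable fun x : EuclideanSpace ℝ (Fin d) => ⌊x i / h⌋₊ :=
    Nat.measurable_floor.comp (by fun_prop)
  exact (Measurable.of_discrete (f := fun k : ℕ => Fin.ofNat N k)).comp h1

/-! ### Volume estimates on the cube. -/

theorem volume_setOf_forall_mem (T : Fin d → Set ℝ) :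
    volume {x : EuclideanSpace ℝ (Fin d) | ∀ i, x i ∈ T i} = ∏ i, volume (T i) := by
  rw [← volume_pi_pi, ← (EuclideanSpace.volume_preserving_symm_measurableEquiv_toLp
    (Fin d)).measure_preimage_equiv]
  congr 1
  ext x
  simp

theorem one_le_mul_ceil_inv (hh : 0 < h) : 1 ≤ h * ⌈h⁻¹⌉₊ := by
  have := mul_le_mul_of_nonneg_left (Nat.le_ceil h⁻¹) hh.le
  rwa [mul_inv_cancel₀ hh.ne'] at this

theorem volume_cube (hh : 0 < h) :
    volume (cube d h) = ENNReal.ofReal ((h * ⌈h⁻¹⌉₊) ^ d) := by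
  rw [cube, volume_setOf_forall_mem]
  simp only [Real.volume_Icc, sub_zero, Finset.prod_const, Finset.card_univ, Fintype.card_fin]
  rw [ENNReal.ofReal_pow (by positivity)]

theorem measurableSet_cube : MeasurableSet (cube d h) := by
  simp only [cube, Set.ofPred_forall]
  exact MeasurableSet.iInter fun i => measurableSet_Icc.preimage (by fun_prop)

theorem one_le_volume_cube (hh : 0 < h) : 1 ≤ volume (cube d h) := by
  rw [volume_cube hh, ENNReal.one_le_ofReal]
  exact one_le_pow₀ (one_le_mul_ceil_inv hh)

theorem isProbabilityMeasure_designLaw (hh : 0 < h) : IsProbabilityMeasure (designLaw d h) := by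
  refine cond_isProbabilityMeasure_of_finite (zero_lt_one.trans_le (one_le_volume_cube hh)).ne' ?_
  rw [volume_cube hh]
  exact ENNReal.ofReal_ne_top

/-- The side `h ⌈h⁻¹⌉` is at least 1, so the uniform density is at most 1. -/
theorem designLaw_le_restrict (hh : 0 < h) : designLaw d h ≤ volume.restrict (cube d h) := by
  refine Measure.le_iff.2 fun s hs => ?_
  rw [designLaw, ProbabilityTheory.cond, Measure.smul_apply, smul_eq_mul]
  exact mul_le_of_le_one_left' (ENNReal.inv_le_one.2 (one_le_volume_cube hh))

/-- In each coordinate the middle halves of the `N` intervals fill half of the side. -/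
theorem le_designLaw_setOf_le_wallDist [NeZero d] (hh : 0 < h) :
    ENNReal.ofReal ((1 / 2) ^ d) ≤ designLaw d h {x | h / 4 ≤ wallDist d h x} := by
  set N := ⌈h⁻¹⌉₊ with hN
  have hN1 : 1 ≤ h * N := one_le_mul_ceil_inv hh
  let T : Set ℝ := ⋃ k ∈ Finset.range N, Set.Icc (h * k + h / 4) (h * k + 3 * h / 4)
  have hT : volume T = ENNReal.ofReal (h * N / 2) := by
    rw [measure_biUnion_finset]
    · simp only [Real.volume_Icc]
      rw [Finset.sum_congr rfl (g := fun _ => ENNReal.ofReal (h / 2))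
        fun k _ => by congr 1; ring]
      rw [Finset.sum_const, Finset.card_range, nsmul_eq_mul, ← ENNReal.ofReal_natCast,
        ← ENNReal.ofReal_mul (by positivity)]
      congr 1
      ring
    · intro a _ b _ hab
      refine Set.disjoint_left.2 fun s hsa hsb => ?_
      obtain ⟨h1, h2⟩ := hsa
      obtain ⟨h3, h4⟩ := hsb
      rcases lt_or_gt_of_ne hab with hlt | hlt
      · have : (a : ℝ) + 1 ≤ b := by exact_mod_cast hlt
        nlinarith
      · have : (b : ℝ) + 1 ≤ a := by exact_mod_cast hlt
        nlinarith
    · exact fun _ _ => measurableSet_Icc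
  have hsub : {x : EuclideanSpace ℝ (Fin d) | ∀ i, x i ∈ T} ⊆
      cube d h ∩ {x | h / 4 ≤ wallDist d h x} := by
    intro x hx
    have hx' (i : Fin d) : ∃ k < N, x i ∈ Set.Icc (h * k + h / 4) (h * k + 3 * h / 4) := by
      simpa only [T, Set.mem_iUnion, Finset.mem_range, exists_prop] using hx i
    refine ⟨fun i => ?_, le_wallDist_iff.2 fun i => ?_⟩
    · obtain ⟨k, hk, h1, h2⟩ := hx' i
      have : (k : ℝ) + 1 ≤ N := by exact_mod_cast hk
      have hk0 : (0 : ℝ) ≤ h * k := by positivity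
      exact ⟨by linarith, by nlinarith⟩
    · obtain ⟨k, _, hk⟩ := hx' i
      exact le_gridDist hh hk
  have hvol := measure_mono (μ := volume) hsub
  rw [volume_setOf_forall_mem] at hvol
  simp only [hT, Finset.prod_const, Finset.card_univ, Fintype.card_fin] at hvol
  rw [designLaw, cond_apply measurableSet_cube, volume_cube hh, ← ENNReal.div_eq_inv_mul,
    ENNReal.le_div_iff_mul_le (by simp; left; positivity) (by simp),
    ← ENNReal.ofReal_mul (by positivity), ← mul_pow]
  rw [← ENNReal.ofReal_pow (by positivity)] at hvol
  convert hvol using 3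
  ring

theorem lintegral_mul_pow_sub (hd : d ≠ 0) (hh : 0 < h) :
    ∫⁻ t in Set.Ioi (0 : ℝ), ENNReal.ofReal (h - 2 * t) ^ d * ENNReal.ofReal t =
      ENNReal.ofReal (h ^ (d + 2) / (4 * (d + 1) * (d + 2))) := by
  have h1 : ∫⁻ t in Set.Ioi (0 : ℝ), ENNReal.ofReal (h - 2 * t) ^ d * ENNReal.ofReal t =
      ∫⁻ t in Set.Ioc (0 : ℝ) (h / 2), ENNReal.ofReal (h - 2 * t) ^ d * ENNReal.ofReal t := by
    rw [← Set.Ioc_union_Ioi_eq_Ioi (by positivity : (0 : ℝ) ≤ h / 2),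
      lintegral_union measurableSet_Ioi (Set.Ioc_disjoint_Ioi le_rfl)]
    -- Past `h/2` the truncated base is 0, and its power vanishes because `d ≠ 0`.
    rw [setLIntegral_congr_fun (s := Set.Ioi (h / 2)) (g := fun _ => 0) measurableSet_Ioi]
    · simp
    · intro t ht
      have : h - 2 * t ≤ 0 := by linarith [Set.mem_Ioi.1 ht]
      simp [ENNReal.ofReal_of_nonpos this, hd]
  have h2 : ∫⁻ t in Set.Ioc (0 : ℝ) (h / 2), ENNReal.ofReal (h - 2 * t) ^ d * ENNReal.ofReal t =
      ∫⁻ t in Set.Ioc (0 : ℝ) (h / 2), ENNReal.ofReal ((h - 2 * t) ^ d * t) := by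
    refine setLIntegral_congr_fun measurableSet_Ioc fun t ht => ?_
    have : 0 ≤ h - 2 * t := by linarith [ht.2]
    rw [ENNReal.ofReal_mul (by positivity), ENNReal.ofReal_pow this]
  have hcont : Continuous fun t : ℝ => (h - 2 * t) ^ d * t := by fun_prop
  rw [h1, h2, ← ofReal_integral_eq_lintegral_ofReal
    (hcont.integrableOn_Icc.mono_set Set.Ioc_subset_Icc_self)]
  · congr 1
    rw [← intervalIntegral.integral_of_le (by positivity),
      intervalIntegral.integral_eq_sub_of_hasDerivAt
        (f := fun t => -(t * (h - 2 * t) ^ (d + 1) / (2 * (d + 1))) -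
          (h - 2 * t) ^ (d + 2) / (4 * (d + 1) * (d + 2)))]
    · rw [mul_div_cancel₀ h (by norm_num : (2 : ℝ) ≠ 0)]
      simp
    · intro t _
      have hb : HasDerivAt (fun t : ℝ => h - 2 * t) (-2) t := by
        simpa using ((hasDerivAt_id t).const_mul 2).const_sub h
      have := ((((hasDerivAt_id t).mul (hb.pow (d + 1))).div_const (2 * ((d : ℝ) + 1))).neg).sub
        ((hb.pow (d + 2)).div_const (4 * ((d : ℝ) + 1) * (d + 2)))
      refine this.congr_deriv ?_
      simp only [Pi.pow_apply, id, Nat.add_sub_cancel, show d + 2 - 1 = d + 1 from rfl]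
      push_cast
      have : (d : ℝ) + 1 ≠ 0 := by positivity
      have : (d : ℝ) + 2 ≠ 0 := by positivity
      field_simp
      ring
    · exact hcont.intervalIntegrable _ _
  · refine (ae_restrict_iff' measurableSet_Ioc).2 (.of_forall fun t ht => ?_)
    have : 0 ≤ h - 2 * t := by linarith [ht.2]
    have := ht.1
    simp only [Pi.zero_apply]
    positivity

end

section

variable {d N : ℕ} {h : ℝ}

/-- Staying `t` away from the walls shrinks a cell to a cube of side `h - 2t`. -/
theorem designLaw_restrict_setOf_le_wallDist_le [NeZero d] [NeZero N] (hh : 0 < h)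
    (hN : N = ⌈h⁻¹⌉₊) (j : Fin d → Fin N) {t : ℝ} (ht : 0 < t) :
    (designLaw d h).restrict (cellIndex d N h ⁻¹' {j}) {x | t ≤ wallDist d h x} ≤
      ENNReal.ofReal (h - 2 * t) ^ d := by
  have hg : Measurable (wallDist d h) := (lipschitzWith_wallDist hh).continuous.measurable
  have hs : MeasurableSet {x | t ≤ wallDist d h x} := measurableSet_le measurable_const hg
  rw [Measure.restrict_apply hs]
  refine (designLaw_le_restrict hh _).trans ?_
  rw [Measure.restrict_apply (hs.inter (measurable_cellIndex .of_discrete))]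
  have hsub : {x | t ≤ wallDist d h x} ∩ cellIndex d N h ⁻¹' {j} ∩ cube d h ⊆
      {x : EuclideanSpace ℝ (Fin d) |
        ∀ i, x i ∈ Set.Icc (h * (j i : ℕ) + t) (h * ((j i : ℕ) + 1) - t)} := by
    rintro x ⟨⟨hx, rfl⟩, hc⟩ i
    obtain ⟨h1, h2⟩ := mem_Icc_of_le_gridDist (N := N) hh (by rw [hN]; exact hc i) ht
      (le_wallDist_iff.1 hx i)
    simpa [cellIndex, Nat.mod_eq_of_lt h1] using h2
  refine (measure_mono hsub).trans ?_
  rw [volume_setOf_forall_mem fun i => Set.Icc (h * (j i : ℕ) + t) (h * ((j i : ℕ) + 1) - t)]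
  simp only [Real.volume_Icc]
  refine le_of_eq ?_
  rw [Finset.prod_congr rfl (g := fun _ => ENNReal.ofReal (h - 2 * t))
    fun i _ => by congr 1; ring]
  simp

theorem integrable_wallDist_sq [NeZero d] (hh : 0 < h) :
    Integrable (fun x => wallDist d h x ^ 2) (designLaw d h) := by
  have := isProbabilityMeasure_designLaw (d := d) hh
  refine Integrable.of_bound
    ((lipschitzWith_wallDist hh).continuous.pow 2).aestronglyMeasurable (h ^ 2) (.of_forall ?_)
  intro x
  rw [Real.norm_of_nonneg (by positivity)]
  refine pow_le_pow_left₀ (wallDist_nonneg x) ((wallDist_le x 0).trans ?_) 2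
  rw [gridDist]
  have h1 : x 0 - h * round (x 0 / h) = h * (x 0 / h - round (x 0 / h)) := by field_simp
  rw [h1, abs_mul, abs_of_pos hh]
  nlinarith [abs_sub_round (x 0 / h)]

/-- The layer-cake formula reduces this to the integral of `2t (h - 2t)^d`. -/
theorem setIntegral_wallDist_sq_le [NeZero d] [NeZero N] (hh : 0 < h)
    (hN : N = ⌈h⁻¹⌉₊) (j : Fin d → Fin N) :
    ∫ x in cellIndex d N h ⁻¹' {j}, wallDist d h x ^ 2 ∂designLaw d h ≤
      h ^ (d + 2) / (2 * (d + 1) * (d + 2)) := by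
  rw [integral_eq_lintegral_of_nonneg_ae (f := fun x => wallDist d h x ^ 2)
    (.of_forall fun x => sq_nonneg _)
    ((lipschitzWith_wallDist hh).continuous.pow 2).aestronglyMeasurable]
  refine ENNReal.toReal_le_of_le_ofReal (by positivity) ?_
  simp_rw [← Real.rpow_two]
  rw [lintegral_rpow_eq_lintegral_meas_le_mul _ (.of_forall wallDist_nonneg)
    (lipschitzWith_wallDist hh).continuous.aemeasurable two_pos]
  calc _ ≤ ENNReal.ofReal 2 *
        ∫⁻ t in Set.Ioi (0 : ℝ), ENNReal.ofReal (h - 2 * t) ^ d * ENNReal.ofReal t := by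
        refine mul_le_mul_right (setLIntegral_mono' measurableSet_Ioi fun t ht => ?_) _
        norm_num
        gcongr
        exact designLaw_restrict_setOf_le_wallDist_le hh hN j ht
    _ = _ := by
        rw [lintegral_mul_pow_sub (NeZero.ne d) hh, ← ENNReal.ofReal_mul (by norm_num)]
        congr 1
        field_simp
        ring

end

/-! ### Assembly and choice of the cell side. -/

theorem pairLaw_eq_observationLaw (d : ℕ) (h σ : ℝ) (r : EuclideanSpace ℝ (Fin d) → ℝ) :
    pairLaw d h σ r = observationLaw (designLaw d h) (σ ^ 2).toNNReal r := rfl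

theorem exists_lipschitzWith_le_jointLaw {d n : ℕ} [NeZero d] {h σ : ℝ} (hh : 0 < h) (hσ : 0 < σ)
    {rhat : EuclideanSpace ℝ (Fin d) → (Fin n → EuclideanSpace ℝ (Fin d) × ℝ) → ℝ}
    (hrhat : Measurable (Function.uncurry rhat)) :
    ∃ r : EuclideanSpace ℝ (Fin d) → ℝ, LipschitzWith 1 r ∧
      ENNReal.ofReal (1 / 4 * Real.exp (-(2 / Real.pi) *
        (n * (h ^ (d + 2) / (2 * (d + 1) * (d + 2))) / σ ^ 2)) * (1 / 2) ^ d) ≤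
      2 * jointLaw d n h σ r {ω | h / 4 ≤ |rhat ω.1 ω.2 - r ω.1|} := by
  have := isProbabilityMeasure_designLaw (d := d) hh
  set N := ⌈h⁻¹⌉₊ with hN
  have : NeZero N := ⟨(Nat.ceil_pos.2 (inv_pos.2 hh)).ne'⟩
  have hσ2 : 0 < σ ^ 2 := by positivity
  obtain ⟨c, hc⟩ := exists_sign_le_measure_abs_sub (μ := designLaw d h) (v := (σ ^ 2).toNNReal)
    (Real.toNNReal_pos.2 hσ2).ne' (measurable_cellIndex (N := N))
    (lipschitzWith_wallDist hh).continuous.measurable (integrable_wallDist_sq hh)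
    (setIntegral_wallDist_sq_le hh hN) (le_designLaw_setOf_le_wallDist hh) hrhat
  refine ⟨_, lipschitzWith_signedProfile hh c, ?_⟩
  rw [Real.coe_toNNReal _ hσ2.le, ← ENNReal.ofReal_mul (by positivity)] at hc
  exact hc

end RegressionLowerBound

theorem mainTheorem1 (d n : ℕ) (hd : 1 ≤ d) (hn : 1 ≤ n) (σ : ℝ) (hσ : 0 < σ)
    (δ : ℝ) (hδ_pos : 0 < δ) (hδ_le : δ ≤ 1 / 2 ^ (d + 3))
    (h : ℝ) (hh_pos : 0 < h)
    (hh : δ < 1 / 2 ^ (d + 3) → h = RegressionLowerBound.cellSide d n σ δ)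
    (rhat : EuclideanSpace ℝ (Fin d) → (Fin n → EuclideanSpace ℝ (Fin d) × ℝ) → ℝ)
    (hrhat : Measurable (Function.uncurry rhat)) :
    ∃ r : EuclideanSpace ℝ (Fin d) → ℝ,
      LipschitzOnWith 1 r (RegressionLowerBound.cube d h) ∧
      ENNReal.ofReal δ ≤ RegressionLowerBound.jointLaw d n h σ r
        {ω | (1 / 4 : ℝ) * (σ ^ 2 * Real.log (1 / (2 ^ (d + 3) * δ)) / (n : ℝ))
              ^ (1 / ((d : ℝ) + 2)) ≤ |rhat ω.1 ω.2 - r ω.1|} := by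
  have : NeZero d := ⟨by omega⟩
  have hdpos : (0 : ℝ) < d := by exact_mod_cast hd
  have hnpos : (0 : ℝ) < n := by exact_mod_cast hn
  have hcpos : (0 : ℝ) < 2 ^ (d + 3) * δ := by positivity
  have hc1 : 2 ^ (d + 3) * δ ≤ 1 := by
    rwa [le_div_iff₀' (by positivity)] at hδ_le
  obtain ⟨r, hr, hle⟩ := RegressionLowerBound.exists_lipschitzWith_le_jointLaw (n := n) hh_pos hσ
    hrhat
  refine ⟨r, hr.lipschitzOnWith, ?_⟩
  set L := Real.log (1 / (2 ^ (d + 3) * δ)) with hL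
  rcases hδ_le.eq_or_lt with heq | hlt
  -- At the boundary value of `δ` the threshold is 0, so the event is certain for any `h`.
  · have hL0 : L = 0 := by
      rw [hL, heq, mul_one_div_cancel (by positivity), div_one, Real.log_one]
    have := RegressionLowerBound.isProbabilityMeasure_designLaw (d := d) hh_pos
    have := RegressionLowerBound.isProbabilityMeasure_observationLaw
      (μ := RegressionLowerBound.designLaw d h) (v := (σ ^ 2).toNNReal) hr.continuous.measurable
    have hprob : IsProbabilityMeasure (RegressionLowerBound.jointLaw d n h σ r) := by
      simp only [RegressionLowerBound.jointLaw, RegressionLowerBound.pairLaw_eq_observationLaw]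
      infer_instance
    have hzero : (0 : ℝ) ^ (1 / ((d : ℝ) + 2)) = 0 := Real.zero_rpow (by positivity)
    simp only [hL0, mul_zero, zero_div, hzero, abs_nonneg, Set.ofPred_true, measure_univ]
    rw [ENNReal.ofReal_le_one, heq, div_le_one (by positivity)]
    exact one_le_pow₀ one_le_two
  · have hLpos : 0 < L := by
      refine Real.log_pos ?_
      rw [lt_div_iff₀' (by positivity)] at hlt
      rw [lt_div_iff₀ hcpos]
      linarith
    have hpi := Real.pi_gt_three
    have hh' := hh hlt
    rw [RegressionLowerBound.cellSide, ← hL] at hh'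
    have hpow : h ^ (d + 2) = Real.pi * σ ^ 2 * (d + 1) * (d + 2) * L / n := by
      rw [hh', ← Real.rpow_natCast, ← Real.rpow_mul (by positivity)]
      push_cast
      rw [one_div_mul_cancel (by positivity), Real.rpow_one]
    have hexp : -(2 / Real.pi) * (n * (h ^ (d + 2) / (2 * (d + 1) * (d + 2))) / σ ^ 2) = -L := by
      rw [hpow]
      field_simp
    -- The stated threshold omits the factor `π (d+1)(d+2) ≥ 1` contained in `h`, so it is at most
    -- `h/4`.
    have hthr : (1 / 4 : ℝ) * (σ ^ 2 * L / n) ^ (1 / ((d : ℝ) + 2)) ≤ h / 4 := by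
      have : (σ ^ 2 * L / n) ^ (1 / ((d : ℝ) + 2)) ≤ h := by
        rw [hh']
        refine Real.rpow_le_rpow (by positivity) ?_ (by positivity)
        gcongr
        have h1 : 1 ≤ Real.pi * (d + 1) * (d + 2) := by nlinarith [mul_pos hdpos hdpos]
        have h2 : 0 ≤ σ ^ 2 := by positivity
        nlinarith [mul_le_mul_of_nonneg_left h1 h2]
      linarith
    have hval : 1 / 4 * Real.exp (-L) * (1 / 2) ^ d = 2 * δ := by
      rw [hL, one_div (2 ^ (d + 3) * δ), Real.log_inv, neg_neg, Real.exp_log hcpos, one_div, one_div,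
        inv_pow, pow_add]
      field_simp
      norm_num
    rw [hexp, hval, ENNReal.ofReal_mul (by norm_num), ENNReal.ofReal_ofNat] at hle
    refine ((ENNReal.mul_le_mul_iff_right (by norm_num) (by norm_num)).1 hle).trans
      (measure_mono fun ω hω => ?_)
    exact hthr.trans hω
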